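/- All vector spaces are over $\mathbb{C}$. Let $(V,Y,\mathbf 1,\omega)$ be a vertex operator superalgebra, with $Y(v,z)=\sum_{n\in\mathbb Z}v_nz^{-n-1}$, $L(n)=\omega_{n+1}$ and $V=\bigoplus_{q\in\frac12\mathbb Z}V_{(q)}$, where $V_{(q)}=\{v\in V\mid L(0)v=qv\}$ is finite-dimensional and vanishes for $q$ sufficiently negative, and where the even (odd) part of $V$ is the sum of the $V_{(q)}$ with $q\in\mathbb Z$ (respectively $q\in\frac12+\mathbb Z$). Suppose that $V$ is simple (that is, $V\neq 0$ and $V$ has no ideals other than $0$ and $V$) and that $V$ is strongly generated by $V_{(3/2)}+V_{(2)}$, that is, $V$ is linearly spanned by $\mathbf 1$ and the vectors $u^{(1)}_{-n_1}\cdots u^{(r)}_{-n_r}\mathbf 1$ with $r\ge 1$, $u^{(i)}\in V_{(3/2)}+V_{(2)}$ and $n_i\ge 1$. Then $$a_0b=\tfrac12L(-1)\,a_1b\qquad\text{for all }a,b\in V_{(2)}.$$ Consequently, $V_{(2)}$ is closed under the product $ab:=a_1b$, which makes it a commutative associative algebra with identity $\tfrac12\omega\in V_{(2)}$; moreover, for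 $a,b\in V_{(2)}$ the equation $a_3b=\langle a,b\rangle\mathbf 1$ with $\langle a,b\rangle\in\mathbb C$ defines a bilinear form on $V_{(2)}$, which is symmetric and associative: $\langle a,b\rangle=\langle b,a\rangle$ and $\langle ab,c\rangle=\langle a,bc\rangle$ for all $a,b,c\in V_{(2)}$. -/

import Mathlib

/-- The raw data underlying a (conformal) vertex superalgebra on a complex vector space `V`:
the vertex operator map `Y(v, z) = ∑ₙ vₙ z⁻ⁿ⁻¹ ∈ (End V)[[z, z⁻¹]]`, stored as the family of its
modes `n ↦ vₙ`, the vacuum vector `𝟏` and the conformal vector `ω`. -/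
structure VertexSuperData (V : Type*) [AddCommGroup V] [Module ℂ V] where
  /-- `Y v n` is the mode `vₙ`, the coefficient of `z⁻ⁿ⁻¹` in `Y(v, z)`. -/
  Y : V →ₗ[ℂ] (ℤ → Module.End ℂ V)
  /-- The vacuum vector. -/
  vac : V
  /-- The conformal (Virasoro) vector. -/
  omega : V

namespace VertexSuperData

variable {V : Type*} [AddCommGroup V] [Module ℂ V] (S : VertexSuperData V)

/-- The mode `vₙ`. -/
def mode (v : V) (n : ℤ) : Module.End ℂ V := S.Y v n

/-- `L(n) = ωₙ₊₁`. -/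
def L (n : ℤ) : Module.End ℂ V := S.mode S.omega (n + 1)

/-- `V_(q) = {v | L(0) v = q v}`. -/
def weightSpace (q : ℚ) : Submodule ℂ V := Module.End.eigenspace (S.L 0) (q : ℂ)

/-- The even part (`α = 0`), resp. odd part (`α = 1`): the sum of the `V_(q)` with
`q ∈ ℤ`, resp. `q ∈ ℤ + 1/2`. -/
def parityPart (α : ZMod 2) : Submodule ℂ V :=
  ⨆ (k : ℤ) (_ : (k : ZMod 2) = α), S.weightSpace ((k : ℚ) / 2)

/-- The vectors `u⁽¹⁾₋ₙ₁ ⋯ u⁽ʳ⁾₋ₙᵣ 𝟏` with `u⁽ⁱ⁾ ∈ T`, `nᵢ ≥ 1` and `r ≥ 0`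
(for `r = 0` this is `𝟏`). -/
def strongWords (T : Set V) : Set V :=
  {x | ∃ l : List (V × ℕ), (∀ p ∈ l, p.1 ∈ T ∧ 1 ≤ p.2) ∧
    x = l.foldr (fun p w => S.mode p.1 (-(p.2 : ℤ)) w) S.vac}

/-- `V` is strongly generated by `T`. -/
def StronglyGeneratedBy (T : Set V) : Prop :=
  Submodule.span ℂ (S.strongWords T) = ⊤

/-- (Two-sided) ideals. -/
def IsIdeal (I : Submodule ℂ V) : Prop :=
  ∀ u : V, ∀ w ∈ I, ∀ n : ℤ, S.mode u n w ∈ I ∧ S.mode w n u ∈ I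

/-- `V` is simple: it is nonzero and its only ideals are `0` and `V`. -/
def IsSimple : Prop :=
  Nontrivial V ∧ ∀ I : Submodule ℂ V, S.IsIdeal I → I = ⊥ ∨ I = ⊤

end VertexSuperData

/-- Conformal vertex superalgebras. -/
structure ConformalVertexSuperalgebra (V : Type*) [AddCommGroup V] [Module ℂ V]
    extends VertexSuperData V where
  /-- `V = ⨁ V_(q)`, the sum over `q ∈ ½ℤ`. -/
  isInternal : DirectSum.IsInternal fun k : ℤ => toVertexSuperData.weightSpace ((k : ℚ) / 2)
  vac_even : vac ∈ toVertexSuperData.parityPart 0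
  omega_even : omega ∈ toVertexSuperData.parityPart 0
  mode_parity : ∀ (α β : ZMod 2), ∀ u ∈ toVertexSuperData.parityPart α,
    ∀ v ∈ toVertexSuperData.parityPart β, ∀ n : ℤ,
      toVertexSuperData.mode u n v ∈ toVertexSuperData.parityPart (α + β)
  truncation : ∀ u v : V, ∃ N : ℤ, ∀ n : ℤ, N ≤ n → toVertexSuperData.mode u n v = 0
  /-- The Jacobi identity in terms of components; all sums are finite by `truncation`. -/
  jacobi : ∀ (α β : ZMod 2), ∀ u ∈ toVertexSuperData.parityPart α,
    ∀ v ∈ toVertexSuperData.parityPart β, ∀ (m n k : ℤ) (w : V),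
      (∑ᶠ i : ℕ, ((-1 : ℂ) ^ i * (Ring.choose m i : ℤ)) •
        (toVertexSuperData.mode u (m + k - i) (toVertexSuperData.mode v (n + i) w)
          - ((-1 : ℂ) ^ (α.val * β.val) * (-1 : ℂ) ^ m) •
            toVertexSuperData.mode v (m + n - i) (toVertexSuperData.mode u (k + i) w)))
      = ∑ᶠ i : ℕ, ((Ring.choose k i : ℤ) : ℂ) •
          toVertexSuperData.mode (toVertexSuperData.mode u (m + i) v) (n + k - i) w
  vac_mode : ∀ (m : ℤ) (v : V), toVertexSuperData.mode vac m v = if m = -1 then v else 0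
  creation : ∀ v : V, toVertexSuperData.mode v (-1) vac = v
  creation_nonneg : ∀ (v : V) (n : ℕ), toVertexSuperData.mode v (n : ℤ) vac = 0
  /-- The central charge. -/
  centralCharge : ℂ
  virasoro : ∀ m n : ℤ,
    toVertexSuperData.L m * toVertexSuperData.L n - toVertexSuperData.L n * toVertexSuperData.L m
      = ((m : ℂ) - (n : ℂ)) • toVertexSuperData.L (m + n)
        + if m + n = 0 then (((m : ℂ) ^ 3 - (m : ℂ)) / 12 * centralCharge) • 1 else 0
  /-- `Y(L(-1)v, z) = d/dz Y(v, z)`. -/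
  L_neg_one_derivative : ∀ (v : V) (n : ℤ),
    toVertexSuperData.mode (toVertexSuperData.L (-1) v) n
      = (-(n : ℂ)) • toVertexSuperData.mode v (n - 1)

/-- Vertex operator superalgebras: conformal vertex superalgebras with finite-dimensional weight
spaces, such that `V_(q) = 0` for `q ∈ ½ℤ` sufficiently negative. -/
structure VertexOperatorSuperalgebra (V : Type*) [AddCommGroup V] [Module ℂ V]
    extends ConformalVertexSuperalgebra V where
  finiteDimensional_weightSpace : ∀ k : ℤ,
    FiniteDimensional ℂ (toVertexSuperData.weightSpace ((k : ℚ) / 2))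
  weightSpace_eq_bot : ∃ N : ℤ, ∀ k : ℤ, k < N →
    toVertexSuperData.weightSpace ((k : ℚ) / 2) = ⊥

/-! Strong generation leaves no vectors of negative weight or of weight 1/2 or 1, and gives V_(0) =
ℂ𝟏, V_(5/2) = L(-1)V_(3/2), and V_(3) spanned by L(-1)V_(2) and the u₋₁v with u, v in V_(3/2)
(`lowWeightShape`). Simplicity then makes a quasi-primary vector of positive weight vanish once it
pairs to zero with its own weight space (`eq_zero_of_quasiPrimary`).

The vector y = a₀b - ½L(-1)a₁b is quasi-primary of weight 3, and the shape of V_(3) reduces y = 0 to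
u₂y = 0 for u in V_(3/2) (`six_eq_zero`). Now u₂(a₀b) = (4/3) b₁a₁u, so by skew symmetry u₂y is a
multiple of [a₁, b₁]u. This commutator vanishes (`action_comm`): a₁ is self-adjoint for the
symmetric product u₀v and satisfies a₁(u₀v) = (4/3) u₀(a₁v), so moving b₁ to either factor computes
a₁b₁(u₀v) in two ways; L(2) turns u₀ into the pairing u₂, which is nondegenerate on V_(3/2).

Given the formula for a₀b, the commutators [a₁, b₁] and [a₃, b₁] yield associativity of the product
and of the form. -/

namespace VertexSuperData

variable {V : Type*} [AddCommGroup V] [Module ℂ V] (S : VertexSuperData V)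

@[simp] lemma mode_add (u v : V) (n : ℤ) : S.mode (u + v) n = S.mode u n + S.mode v n := by
  simp [mode]

@[simp] lemma mode_smul (c : ℂ) (u : V) (n : ℤ) : S.mode (c • u) n = c • S.mode u n := by
  simp [mode]

@[simp] lemma mode_zero (n : ℤ) : S.mode 0 n = 0 := by
  simp [mode]

lemma mode_omega (n : ℤ) : S.mode S.omega n = S.L (n - 1) := by
  simp [L]

/-- The weight space of weight `k / 2`. -/
def halfWeightSpace (k : ℤ) : Submodule ℂ V := S.weightSpace ((k : ℚ) / 2)

variable {S} in
lemma mem_halfWeightSpace {k : ℤ} {x : V} :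
    x ∈ S.halfWeightSpace k ↔ S.L 0 x = ((k : ℂ) / 2) • x := by
  simp [halfWeightSpace, weightSpace]

lemma halfWeightSpace_le_parityPart (k : ℤ) :
    S.halfWeightSpace k ≤ S.parityPart (k : ZMod 2) :=
  le_iSup₂_of_le (f := fun (j : ℤ) (_ : (j : ZMod 2) = (k : ZMod 2)) =>
    S.weightSpace ((j : ℚ) / 2)) k rfl le_rfl

end VertexSuperData

/-! ### Mode identities and weights. -/

namespace ConformalVertexSuperalgebra

open VertexSuperData

variable {V : Type*} [AddCommGroup V] [Module ℂ V] (S : ConformalVertexSuperalgebra V)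

lemma iSup_halfWeightSpace : ⨆ k, S.halfWeightSpace k = ⊤ :=
  S.isInternal.submodule_iSup_eq_top

lemma iSupIndep_halfWeightSpace : iSupIndep S.halfWeightSpace :=
  S.isInternal.submodule_iSupIndep

/-- The commutator formula for a mode of non-negative index. -/
lemma mode_commutator {α β : ZMod 2} {u v : V} (hu : u ∈ S.parityPart α)
    (hv : v ∈ S.parityPart β) (k : ℕ) (n : ℤ) (w : V) :
    S.mode u k (S.mode v n w) = (-1 : ℂ) ^ (α.val * β.val) • S.mode v n (S.mode u k w)
      + ∑ i ∈ Finset.range (k + 1),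
        (k.choose i : ℂ) • S.mode (S.mode u i v) (n + k - i) w := by
  have h := S.jacobi α β u hu v hv 0 n k w
  rw [finsum_eq_single _ 0, finsum_eq_sum_of_support_subset (s := Finset.range (k + 1))] at h
  · simp only [Ring.choose_natCast] at h
    simp at h
    rw [← h]
    abel
  · intro i hi
    by_contra hik
    apply hi
    have : k < i := by simpa using hik
    simp [Ring.choose_natCast, Nat.choose_eq_zero_of_lt this]
  · intro i hi
    rw [Ring.choose_zero_pos _ (Nat.pos_of_ne_zero hi)]
    simp

/-- The associativity formula. -/
lemma mode_mode {α β : ZMod 2} {u v : V} (hu : u ∈ S.parityPart α)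
    (hv : v ∈ S.parityPart β) (m n : ℤ) (w : V) :
    S.mode (S.mode u m v) n w = ∑ᶠ i : ℕ, ((-1 : ℂ) ^ i * (Ring.choose m i : ℤ)) •
      (S.mode u (m - i) (S.mode v (n + i) w)
        - ((-1 : ℂ) ^ (α.val * β.val) * (-1 : ℂ) ^ m) •
          S.mode v (m + n - i) (S.mode u i w)) := by
  have h := S.jacobi α β u hu v hv m n 0 w
  rw [finsum_eq_single (fun i : ℕ => ((Ring.choose (0 : ℤ) i : ℤ) : ℂ) • _) 0] at h
  · simp at h
    simpa using h.symm
  · intro i hi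
    rw [Ring.choose_zero_pos _ (Nat.pos_of_ne_zero hi)]
    simp

lemma mode_vac_of_nonneg (v : V) {n : ℤ} (hn : 0 ≤ n) : S.mode v n S.vac = 0 := by
  lift n to ℕ using hn
  exact S.creation_nonneg v n

/-- Skew symmetry, with the powers of `L(-1)` expressed by modes acting on the vacuum. -/
lemma skew_symmetry {α β : ZMod 2} {u v : V} (hu : u ∈ S.parityPart α)
    (hv : v ∈ S.parityPart β) (m : ℤ) :
    -(((-1 : ℂ) ^ (α.val * β.val) * (-1 : ℂ) ^ m) • S.mode v m u)
      = ∑ᶠ i : ℕ, ((-1 : ℂ) ^ i) • S.mode (S.mode u (m + i) v) (-1 - i) S.vac := by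
  have h := S.jacobi α β u hu v hv m 0 (-1) S.vac
  rw [finsum_eq_single _ 0] at h
  · simp [S.creation, S.mode_vac_of_nonneg] at h
    rw [h]
    refine finsum_congr fun i => ?_
    have hc : Ring.choose (-1 : ℤ) i = (-1) ^ i := by
      rw [show (-1 : ℤ) = -((1 : ℕ) : ℤ) by simp, Ring.choose_neg]
      simp [Int.negOnePow_def, Units.smul_def, Ring.choose_natCast]
    simp [hc]
  · intro i hi
    have h1 : S.mode v i S.vac = 0 := S.mode_vac_of_nonneg v (by positivity)
    have h2 : S.mode u (-1 + i) S.vac = 0 := S.mode_vac_of_nonneg u (by omega)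
    simp [h1, h2]

lemma L_zero_vac : S.L 0 S.vac = 0 := S.mode_vac_of_nonneg _ (by simp)

lemma L_neg_one_vac : S.L (-1) S.vac = 0 := S.mode_vac_of_nonneg _ (by simp)

lemma vac_mem : S.vac ∈ S.halfWeightSpace 0 := by
  simp [mem_halfWeightSpace, L_zero_vac]

lemma omega_mem : S.omega ∈ S.halfWeightSpace 4 := by
  -- ω = L(-2)𝟏 and [L(0), L(-2)] = 2L(-2), with no central term.
  have h := congrArg (fun f : Module.End ℂ V => f S.vac) (S.virasoro 0 (-2))
  have h2 : S.L (-2) S.vac = S.omega := S.creation S.omega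
  simp [L_zero_vac, h2] at h
  rw [mem_halfWeightSpace, h]
  norm_num

lemma L_commutator {p : ℤ} {v : V} (hv : v ∈ S.halfWeightSpace p) (k : ℕ) (n : ℤ) (w : V) :
    S.L (k - 1) (S.mode v n w) = S.mode v n (S.L (k - 1) w)
      + ∑ i ∈ Finset.range (k + 1), (k.choose i : ℂ) • S.mode (S.L (i - 1) v) (n + k - i) w := by
  have h := S.mode_commutator S.omega_even (S.halfWeightSpace_le_parityPart p hv) k n w
  simpa [mode_omega] using h

lemma L_zero_mode {p : ℤ} {v : V} (hv : v ∈ S.halfWeightSpace p) (n : ℤ) (w : V) :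
    S.L 0 (S.mode v n w) = S.mode v n (S.L 0 w) + ((p : ℂ) / 2 - n - 1) • S.mode v n w := by
  have h := S.L_commutator hv 1 n w
  simp [S.L_neg_one_derivative, Finset.sum_range_succ, mem_halfWeightSpace.1 hv] at h
  rw [h]
  module

lemma L_one_mode {p : ℤ} {v : V} (hv : v ∈ S.halfWeightSpace p) (n : ℤ) (w : V) :
    S.L 1 (S.mode v n w) = S.mode v n (S.L 1 w) + ((p : ℂ) - n - 2) • S.mode v (n + 1) w
      + S.mode (S.L 1 v) n w := by
  have h := S.L_commutator hv 2 n w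
  simp [S.L_neg_one_derivative, Finset.sum_range_succ, mem_halfWeightSpace.1 hv] at h
  rw [show n + 2 - 1 = n + 1 by ring] at h
  rw [h]
  module

lemma mode_mem {p q r : ℤ} {u v : V} (hu : u ∈ S.halfWeightSpace p)
    (hv : v ∈ S.halfWeightSpace q) (m : ℤ) (hr : p + q - 2 * m - 2 = r) :
    S.mode u m v ∈ S.halfWeightSpace r := by
  rw [mem_halfWeightSpace, S.L_zero_mode hu, mem_halfWeightSpace.1 hv, ← hr]
  push_cast
  simp only [map_smul]
  module

lemma L_mem {q r : ℤ} {v : V} (hv : v ∈ S.halfWeightSpace q) (m : ℤ) (hr : q - 2 * m = r) :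
    S.L m v ∈ S.halfWeightSpace r :=
  S.mode_mem S.omega_mem hv (m + 1) (by omega)

lemma L_one_L_neg_one {p : ℤ} {v : V} (hv : v ∈ S.halfWeightSpace p) :
    S.L 1 (S.L (-1) v) = S.L (-1) (S.L 1 v) + (p : ℂ) • v := by
  have h := congrArg (fun f : Module.End ℂ V => f v) (S.virasoro 1 (-1))
  simp [mem_halfWeightSpace.1 hv] at h
  rw [sub_eq_iff_eq_add] at h
  rw [h]
  module

/-- `z₋₁₋ᵢ 𝟏 = L(-1)ⁱ z / i!` lies in every `L(-1)`-stable subspace containing `z`. -/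
lemma mode_vac_mem {I : Submodule ℂ V} (hI : ∀ z ∈ I, S.L (-1) z ∈ I) (i : ℕ) :
    ∀ z ∈ I, S.mode z (-1 - i) S.vac ∈ I := by
  induction i with
  | zero => intro z hz; simpa [S.creation] using hz
  | succ i ih =>
    intro z hz
    have h := ih _ (hI z hz)
    rw [S.L_neg_one_derivative, LinearMap.smul_apply] at h
    have hne : (-((-1 - (i : ℤ) : ℤ) : ℂ)) ≠ 0 := by
      have : (i : ℂ) + 1 ≠ 0 := by exact_mod_cast Nat.succ_ne_zero i
      intro h0
      apply this
      push_cast at h0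
      linear_combination h0
    have := (Submodule.smul_mem_iff I hne).1 h
    convert this using 3
    push_cast
    ring

/-! ### Ideals generated by one vector, and nondegeneracy from simplicity. -/

/-- The span of all `uₖ y`. -/
def leftIdeal (y : V) : Submodule ℂ V :=
  Submodule.span ℂ {x | ∃ u : V, ∃ k : ℤ, x = S.mode u k y}

lemma mode_mem_leftIdeal (y u : V) (k : ℤ) : S.mode u k y ∈ S.leftIdeal y :=
  Submodule.subset_span ⟨u, k, rfl⟩

/-- Statements that are linear in a vector need only be checked on homogeneous vectors. -/
lemma homogeneous_induction {P : V → Prop} (h : ∀ k, ∀ x ∈ S.halfWeightSpace k, P x)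
    (h0 : P 0) (hadd : ∀ x y, P x → P y → P (x + y)) (x : V) : P x := by
  have hx : x ∈ ⨆ k, S.halfWeightSpace k := by rw [S.iSup_halfWeightSpace]; trivial
  exact Submodule.iSup_induction _ (motive := P) hx h h0 hadd

/-- Descending induction on n, starting where vₙy = 0. Taking the last Jacobi index N with u_{N+i}y
= 0 removes the terms with v outside; what is left besides uₘvₙy has larger n or is a single mode
applied to y. -/
lemma mode_mode_mem_leftIdeal {p q : ℤ} {u v : V} (hu : u ∈ S.halfWeightSpace p)
    (hv : v ∈ S.halfWeightSpace q) (y : V) (m n : ℤ) :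
    S.mode u m (S.mode v n y) ∈ S.leftIdeal y := by
  obtain ⟨N, hN⟩ := S.truncation u y
  obtain ⟨M, hM⟩ := S.truncation v y
  suffices h : ∀ d : ℕ, ∀ n, M ≤ n + d → ∀ m, S.mode u m (S.mode v n y) ∈ S.leftIdeal y from
    h (M - n).toNat n (by omega) m
  intro d
  induction d with
  | zero =>
    intro n hn m
    rw [hM n (by simpa using hn), map_zero]
    exact zero_mem _
  | succ d ih =>
    intro n hn m
    have h := S.jacobi _ _ u (S.halfWeightSpace_le_parityPart p hu) v
      (S.halfWeightSpace_le_parityPart q hv) (m - N) n N y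
    have hR : ∀ i : ℕ, ((Ring.choose N i : ℤ) : ℂ) •
        S.mode (S.mode u (m - N + i) v) (n + N - i) y ∈ S.leftIdeal y := fun i =>
      Submodule.smul_mem _ _ (S.mode_mem_leftIdeal _ _ _)
    have hR' := finsum_mem_induction (p := fun x => x ∈ S.leftIdeal y) (zero_mem _)
      (fun _ _ => add_mem) (s := Set.univ) (fun i _ => hR i)
    rw [finsum_mem_univ, ← h] at hR'
    rw [finsum_eq_sum_of_support_subset (s := Finset.range (d + 1)),
      Finset.sum_range_succ'] at hR'
    · rw [add_comm] at hR'
      have h2 := (Submodule.add_mem_iff_left (S.leftIdeal y) ?_).1 hR'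
      · simpa [hN] using h2
      · refine sum_mem fun i hi => Submodule.smul_mem _ _ (Submodule.sub_mem _ ?_ ?_)
        · exact ih _ (by push_cast at hn ⊢; omega) _
        · rw [hN _ (by omega)]
          simp
    · intro i hi
      by_contra hid
      apply hi
      have hid' : d + 1 ≤ i := by simpa using hid
      have h1 : S.mode v (n + i) y = 0 := hM _ (by push_cast at hn; omega)
      have h2 : S.mode u (N + i) y = 0 := hN _ (by omega)
      simp [h1, h2]

lemma mode_mem_leftIdeal_of_mem {y x : V} (hx : x ∈ S.leftIdeal y) (u : V) (n : ℤ) :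
    S.mode u n x ∈ S.leftIdeal y := by
  induction hx using Submodule.span_induction with
  | mem x hx =>
    obtain ⟨v, k, rfl⟩ := hx
    refine S.homogeneous_induction (P := fun u => S.mode u n (S.mode v k y) ∈ S.leftIdeal y)
      (fun p u hu => ?_) (by simp) (fun a b ha hb => by simpa using add_mem ha hb) u
    refine S.homogeneous_induction (P := fun v => S.mode u n (S.mode v k y) ∈ S.leftIdeal y)
      (fun q v hv => ?_) (by simp) (fun a b ha hb => by simpa using add_mem ha hb) v
    exact S.mode_mode_mem_leftIdeal hu hv y n k
  | zero => simp
  | add a b _ _ ha hb => simpa using add_mem ha hb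
  | smul c a _ ha => simpa using Submodule.smul_mem _ c ha

/-- Skew symmetry turns right multiplication into left multiplication followed by powers of L(-1),
which is itself a mode of ω. -/
lemma isIdeal_leftIdeal {r : ℤ} {y : V} (hy : y ∈ S.halfWeightSpace r) :
    S.IsIdeal (S.leftIdeal y) := by
  intro u w hw n
  refine ⟨S.mode_mem_leftIdeal_of_mem hw u n, ?_⟩
  have hL : ∀ z ∈ S.leftIdeal y, S.L (-1) z ∈ S.leftIdeal y := fun z hz =>
    S.mode_mem_leftIdeal_of_mem hz _ _
  induction hw using Submodule.span_induction with
  | mem x hx =>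
    obtain ⟨v, k, rfl⟩ := hx
    refine S.homogeneous_induction (P := fun u => S.mode (S.mode v k y) n u ∈ S.leftIdeal y)
      (fun p u hu => ?_) (by simp) (fun a b ha hb => by simpa using add_mem ha hb) u
    refine S.homogeneous_induction (P := fun v => S.mode (S.mode v k y) n u ∈ S.leftIdeal y)
      (fun q v hv => ?_) (by simp) (fun a b ha hb => by simpa using add_mem ha hb) v
    have h := S.skew_symmetry (S.halfWeightSpace_le_parityPart _ hu)
      (S.halfWeightSpace_le_parityPart _ (S.mode_mem hv hy k rfl)) n
    have hR : ∀ i : ℕ, ((-1 : ℂ) ^ i) •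
        S.mode (S.mode u (n + i) (S.mode v k y)) (-1 - i) S.vac ∈ S.leftIdeal y := fun i =>
      Submodule.smul_mem _ _ (S.mode_vac_mem hL _ _
        (S.mode_mem_leftIdeal_of_mem (S.mode_mem_leftIdeal _ _ _) _ _))
    have hR' := finsum_mem_induction (p := fun x => x ∈ S.leftIdeal y) (zero_mem _)
      (fun _ _ => add_mem) (s := Set.univ) (fun i _ => hR i)
    rw [finsum_mem_univ, ← h, Submodule.neg_mem_iff, Submodule.smul_mem_iff] at hR'
    · exact hR'
    · exact mul_ne_zero (pow_ne_zero _ (by norm_num)) (zpow_ne_zero _ (by norm_num))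
  | zero => simp
  | add a b _ _ ha hb => simpa using add_mem ha hb
  | smul c a _ ha => simpa using Submodule.smul_mem _ c ha

variable {S}

lemma vac_ne_zero (hs : S.IsSimple) : S.vac ≠ 0 := by
  intro h
  obtain ⟨x, hx⟩ := @exists_ne V hs.1 0
  apply hx
  rw [← S.creation x, h, map_zero]

/-- In a simple algebra a homogeneous vector none of whose images has weight zero vanishes. -/
lemma eq_zero_of_mode_eq_zero (hs : S.IsSimple) {r : ℤ} {y : V} (hy : y ∈ S.halfWeightSpace r)
    (h : ∀ p, ∀ w ∈ S.halfWeightSpace p, ∀ m : ℤ, p + r - 2 * m - 2 = 0 → S.mode w m y = 0) :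
    y = 0 := by
  have hle : S.leftIdeal y ≤ ⨆ (k : ℤ) (_ : k ≠ 0), S.halfWeightSpace k := by
    refine Submodule.span_le.2 ?_
    rintro _ ⟨u, k, rfl⟩
    refine S.homogeneous_induction
      (P := fun u => S.mode u k y ∈ ⨆ (k : ℤ) (_ : k ≠ 0), S.halfWeightSpace k)
      (fun p u hu => ?_) (by simp) (fun a b ha hb => by simpa using add_mem ha hb) u
    by_cases h0 : p + r - 2 * k - 2 = 0
    · rw [h p u hu k h0]
      exact zero_mem _
    · exact (le_iSup₂_of_le (f := fun (k : ℤ) (_ : k ≠ 0) => S.halfWeightSpace k) _ h0 le_rfl)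
        (S.mode_mem hu hy k rfl)
  have hbot : S.leftIdeal y = ⊥ := by
    refine (hs.2 _ (S.isIdeal_leftIdeal hy)).resolve_right fun htop => ?_
    have hd := S.iSupIndep_halfWeightSpace 0
    exact vac_ne_zero hs (Submodule.disjoint_def.1 hd _ S.vac_mem (hle (htop ▸ trivial)))
  have := S.mode_mem_leftIdeal y S.vac (-1)
  simpa [hbot, S.vac_mode] using this

/-- In a simple algebra of CFT type without vectors of weight one, a quasi-primary vector
orthogonal to all vectors of its own weight vanishes. -/
lemma eq_zero_of_quasiPrimary (hs : S.IsSimple) (hneg : ∀ k < 0, S.halfWeightSpace k = ⊥)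
    (h2 : S.halfWeightSpace 2 = ⊥) {r : ℤ} (hr : 0 < r) {y : V} (hy : y ∈ S.halfWeightSpace r)
    (hL : S.L 1 y = 0) (h : ∀ w ∈ S.halfWeightSpace r, S.mode w (r - 1) y = 0) : y = 0 := by
  suffices H : ∀ d : ℕ, ∀ p : ℤ, p < d → ∀ w ∈ S.halfWeightSpace p, ∀ m : ℤ,
      p + r - 2 * m - 2 = 0 → S.mode w m y = 0 from
    eq_zero_of_mode_eq_zero hs hy fun p => H (p + 1).toNat p (by omega)
  intro d
  induction d with
  | zero =>
    intro p hp w hw m _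
    rw [hneg p (by simpa using hp), Submodule.mem_bot] at hw
    simp [hw]
  | succ d ih =>
    intro p hp w hw m hm
    by_cases hpr : p = r
    · subst hpr
      obtain rfl : m = p - 1 := by omega
      exact h w hw
    -- This vector has weight 1, hence is zero. Applying L(1) gives ((p - r)/2) wₘy plus a term with
    -- L(1)w, of smaller weight than w.
    have h0 : S.mode w (m - 1) y ∈ S.halfWeightSpace 2 := S.mode_mem hw hy _ (by omega)
    rw [h2, Submodule.mem_bot] at h0
    have h1 := S.L_one_mode hw (m - 1) y
    rw [h0, hL, ih (p - 2) (by push_cast at hp; omega) _ (S.L_mem hw 1 (by omega)) (m - 1)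
      (by omega)] at h1
    simp only [map_zero, zero_add, add_zero, sub_add_cancel] at h1
    refine (smul_eq_zero.1 h1.symm).resolve_left fun h3 => hpr ?_
    have h4 : ((p - (m - 1) - 2 : ℤ) : ℂ) = 0 := by push_cast at h3 ⊢; exact h3
    have h5 : p - (m - 1) - 2 = 0 := by exact_mod_cast h4
    omega

/-! ### Low weights under strong generation. -/

variable (S)

/-- The span of the strong words of weight `k / 2` in generators of weights `3 / 2` and `2`
(all vectors of weight `k / 2` when `7 ≤ k`). -/
def strongPart (k : ℤ) : Submodule ℂ V :=
  if k = 0 then Submodule.span ℂ {S.vac}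
  else if k = 3 ∨ k = 4 ∨ 7 ≤ k then S.halfWeightSpace k
  else if k = 5 then (S.halfWeightSpace 3).map (S.L (-1))
  else if k = 6 then (S.halfWeightSpace 4).map (S.L (-1)) ⊔
    Submodule.span ℂ {x | ∃ u ∈ S.halfWeightSpace 3, ∃ v ∈ S.halfWeightSpace 3,
      x = S.mode u (-1) v}
  else ⊥

lemma strongPart_le (k : ℤ) : S.strongPart k ≤ S.halfWeightSpace k := by
  unfold strongPart
  split_ifs with h0 h1 h5 h6
  · subst h0
    simpa using S.vac_mem
  · exact le_rfl
  · subst h5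
    rintro _ ⟨x, hx, rfl⟩
    exact S.L_mem hx _ (by norm_num)
  · subst h6
    refine sup_le ?_ (Submodule.span_le.2 ?_)
    · rintro _ ⟨x, hx, rfl⟩
      exact S.L_mem hx _ (by norm_num)
    · rintro _ ⟨u, hu, v, hv, rfl⟩
      exact S.mode_mem hu hv _ (by norm_num)
  · exact bot_le

lemma mode_neg_two_vac (u : V) : S.mode u (-2) S.vac = S.L (-1) u := by
  have h := S.L_neg_one_derivative u (-1)
  have h2 := congrArg (fun f : Module.End ℂ V => f S.vac) h
  simpa [S.creation] using h2.symm

/-- Stability under the creation modes of the generators puts every strong word in the sum. Below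
weight 7/2 only u₋₁𝟏, u₋₂𝟏 and u₋₁x with u, x of weight 3/2 can occur. -/
lemma mode_mem_iSup_strongPart {p : ℤ} (hp : p = 3 ∨ p = 4) {u : V}
    (hu : u ∈ S.halfWeightSpace p) {n : ℕ} (hn : 1 ≤ n) {x : V}
    (hx : x ∈ ⨆ k, S.strongPart k) : S.mode u (-(n : ℤ)) x ∈ ⨆ k, S.strongPart k := by
  have hmem : ∀ k x, x ∈ S.strongPart k → x ∈ ⨆ k, S.strongPart k := fun k _ h =>
    le_iSup S.strongPart k h
  have hbig : ∀ k x, 7 ≤ k → x ∈ S.halfWeightSpace k → x ∈ ⨆ k, S.strongPart k := by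
    intro k x hk hx
    refine hmem k x ?_
    rw [strongPart, if_neg (by omega), if_pos (by omega)]
    exact hx
  refine Submodule.iSup_induction _
    (motive := fun x => S.mode u (-(n : ℤ)) x ∈ ⨆ k, S.strongPart k) hx (fun k x hx => ?_)
    (by simp) (fun a b ha hb => by simpa using add_mem ha hb)
  have hx' := S.strongPart_le k hx
  by_cases h7 : 7 ≤ p + k + 2 * n - 2
  · exact hbig _ _ h7 (S.mode_mem hu hx' _ (by ring))
  by_cases h0 : k = 0
  · subst h0
    rw [strongPart, if_pos rfl, Submodule.mem_span_singleton] at hx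
    obtain ⟨c, rfl⟩ := hx
    rw [map_smul]
    refine Submodule.smul_mem _ _ ?_
    obtain rfl | rfl : n = 1 ∨ n = 2 := by omega
    · rw [Nat.cast_one, S.creation]
      refine hmem p u ?_
      rw [strongPart, if_neg (by omega), if_pos (by omega)]
      exact hu
    · rw [Nat.cast_ofNat, mode_neg_two_vac]
      refine hmem (p + 2) _ ?_
      have hLu : S.L (-1) u ∈ (S.halfWeightSpace p).map (S.L (-1)) := ⟨u, hu, rfl⟩
      obtain rfl | rfl := hp
      · simpa [strongPart] using hLu
      · simpa [strongPart] using Submodule.mem_sup_left hLu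
  by_cases h3 : k = 3
  · subst h3
    obtain rfl : p = 3 := by omega
    obtain rfl : n = 1 := by omega
    refine hmem 6 _ ?_
    simp only [strongPart]
    norm_num
    exact Submodule.mem_sup_right (Submodule.subset_span ⟨u, hu, x, hx', rfl⟩)
  · rw [strongPart, if_neg h0, if_neg (by omega), if_neg (by omega), if_neg (by omega),
      Submodule.mem_bot] at hx
    simp [hx]

variable {S}

lemma iSup_strongPart (hgen : S.StronglyGeneratedBy
      ((S.weightSpace (3 / 2) ⊔ S.weightSpace 2 : Submodule ℂ V) : Set V)) :
    ⨆ k, S.strongPart k = ⊤ := by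
  rw [eq_top_iff, ← hgen, Submodule.span_le]
  rintro _ ⟨l, hl, rfl⟩
  induction l with
  | nil =>
    refine le_iSup S.strongPart 0 ?_
    simp [strongPart]
  | cons p l ih =>
    have ih' := ih fun q hq => hl q (List.mem_cons_of_mem _ hq)
    obtain ⟨hp, hn⟩ := hl p List.mem_cons_self
    obtain ⟨u, hu, v, hv, huv⟩ := Submodule.mem_sup.1 hp
    have e3 : S.halfWeightSpace 3 = S.weightSpace (3 / 2) := by simp [halfWeightSpace]
    have e4 : S.halfWeightSpace 4 = S.weightSpace 2 := by norm_num [halfWeightSpace]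
    rw [List.foldr_cons, ← huv, mode_add]
    exact add_mem (S.mode_mem_iSup_strongPart (Or.inl rfl) (e3 ▸ hu) hn ih')
      (S.mode_mem_iSup_strongPart (Or.inr rfl) (e4 ▸ hv) hn ih')

/-- Subspaces of independent summands that together span everything must fill each summand. -/
lemma halfWeightSpace_eq_strongPart (hgen : S.StronglyGeneratedBy
      ((S.weightSpace (3 / 2) ⊔ S.weightSpace 2 : Submodule ℂ V) : Set V)) (k : ℤ) :
    S.halfWeightSpace k = S.strongPart k := by
  refine le_antisymm (fun x hx => ?_) (S.strongPart_le k)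
  have htop : x ∈ S.strongPart k ⊔ ⨆ (j : ℤ) (_ : j ≠ k), S.strongPart j := by
    have : S.strongPart k ⊔ ⨆ (j : ℤ) (_ : j ≠ k), S.strongPart j = ⨆ j, S.strongPart j := by
      rw [iSup_split_single S.strongPart k]
    rw [this, iSup_strongPart hgen]
    trivial
  obtain ⟨y, hy, z, hz, rfl⟩ := Submodule.mem_sup.1 htop
  have hz1 : z ∈ S.halfWeightSpace k := by
    simpa using sub_mem hx (S.strongPart_le k hy)
  have hz2 : z ∈ ⨆ (j : ℤ) (_ : j ≠ k), S.halfWeightSpace j :=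
    iSup₂_mono (fun j _ => S.strongPart_le j) hz
  rw [Submodule.disjoint_def.1 (S.iSupIndep_halfWeightSpace k) z hz1 hz2, add_zero]
  exact hy

/-- The low-weight consequences of strong generation by vectors of weights `3 / 2` and `2`. -/
structure LowWeightShape (S : ConformalVertexSuperalgebra V) : Prop where
  eq_bot : ∀ k : ℤ, k ≤ 2 → k ≠ 0 → S.halfWeightSpace k = ⊥
  zero_le : S.halfWeightSpace 0 ≤ Submodule.span ℂ {S.vac}
  five_le : S.halfWeightSpace 5 ≤ (S.halfWeightSpace 3).map (S.L (-1))
  six_le : S.halfWeightSpace 6 ≤ (S.halfWeightSpace 4).map (S.L (-1)) ⊔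
    Submodule.span ℂ {x | ∃ u ∈ S.halfWeightSpace 3, ∃ v ∈ S.halfWeightSpace 3,
      x = S.mode u (-1) v}

lemma lowWeightShape (hgen : S.StronglyGeneratedBy
      ((S.weightSpace (3 / 2) ⊔ S.weightSpace 2 : Submodule ℂ V) : Set V)) :
    S.LowWeightShape where
  eq_bot k hk h0 := by
    rw [halfWeightSpace_eq_strongPart hgen, strongPart, if_neg h0, if_neg (by omega),
      if_neg (by omega), if_neg (by omega)]
  zero_le := by
    rw [halfWeightSpace_eq_strongPart hgen, strongPart, if_pos rfl]
  five_le := by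
    rw [halfWeightSpace_eq_strongPart hgen 5]
    simp [strongPart]
  six_le := by
    rw [halfWeightSpace_eq_strongPart hgen 6]
    simp [strongPart]

/-! ### Products of vectors of weights 3/2 and 2. -/

namespace LowWeightShape

variable (h : S.LowWeightShape)

include h

lemma eq_zero {k : ℤ} {x : V} (hx : x ∈ S.halfWeightSpace k) (hk : k ≤ 2) (h0 : k ≠ 0) :
    x = 0 := by
  rwa [h.eq_bot k hk h0, Submodule.mem_bot] at hx

lemma mode_eq_zero {p q : ℤ} {u v : V} (hu : u ∈ S.halfWeightSpace p)
    (hv : v ∈ S.halfWeightSpace q) (m : ℤ) (hk : p + q - 2 * m ≤ 4) (h0 : p + q - 2 * m ≠ 2) :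
    S.mode u m v = 0 :=
  h.eq_zero (S.mode_mem hu hv m rfl) (by omega) (by omega)

lemma mem_span_vac {k : ℤ} {x : V} (hx : x ∈ S.halfWeightSpace k) (hk : k ≤ 2) :
    x ∈ Submodule.span ℂ {S.vac} := by
  by_cases h0 : k = 0
  · subst h0
    exact h.zero_le hx
  · rw [h.eq_zero hx hk h0]
    exact zero_mem _

lemma L_neg_one_eq_zero {k : ℤ} {x : V} (hx : x ∈ S.halfWeightSpace k) (hk : k ≤ 2) :
    S.L (-1) x = 0 := by
  obtain ⟨c, rfl⟩ := Submodule.mem_span_singleton.1 (h.mem_span_vac hx hk)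
  simp [S.L_neg_one_vac]

lemma L_one_eq_zero {p : ℤ} {x : V} (hx : x ∈ S.halfWeightSpace p) (hp : p = 3 ∨ p = 4) :
    S.L 1 x = 0 :=
  h.eq_zero (S.L_mem hx 1 rfl) (by omega) (by omega)

/-- Skew symmetry when at most two terms survive. -/
lemma skew {p q : ℤ} {u v : V} (hu : u ∈ S.halfWeightSpace p) (hv : v ∈ S.halfWeightSpace q)
    (n : ℤ) (hn : p + q - 2 * n ≤ 8) :
    -(((-1 : ℂ) ^ ((p : ZMod 2).val * (q : ZMod 2).val) * (-1 : ℂ) ^ n) • S.mode v n u)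
      = S.mode u n v - S.L (-1) (S.mode u (n + 1) v) := by
  rw [S.skew_symmetry (S.halfWeightSpace_le_parityPart p hu)
    (S.halfWeightSpace_le_parityPart q hv) n,
    finsum_eq_sum_of_support_subset (s := Finset.range 2)]
  · simp [Finset.sum_range_succ, S.creation, S.mode_neg_two_vac, sub_eq_add_neg]
  -- For i ≥ 2 the vector u_{n+i}v has weight at most 1, so it is a multiple of 𝟏, whose mode -1-i
  -- is zero.
  · intro i hi
    by_contra hi2
    apply hi
    have hi2' : 2 ≤ i := by rwa [Finset.mem_coe, Finset.mem_range, not_lt] at hi2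
    obtain ⟨c, hc⟩ := Submodule.mem_span_singleton.1
      (h.mem_span_vac (S.mode_mem hu hv (n + i) rfl) (by omega))
    have : (-1 - (i : ℤ)) ≠ -1 := by omega
    simp [← hc, S.vac_mode, this]

/-- Skew symmetry when only one term survives. -/
lemma skew' {p q : ℤ} {u v : V} (hu : u ∈ S.halfWeightSpace p) (hv : v ∈ S.halfWeightSpace q)
    (n : ℤ) (hn : p + q - 2 * n ≤ 6) :
    -(((-1 : ℂ) ^ ((p : ZMod 2).val * (q : ZMod 2).val) * (-1 : ℂ) ^ n) • S.mode v n u)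
      = S.mode u n v := by
  rw [h.skew hu hv n (by omega),
    h.L_neg_one_eq_zero (S.mode_mem hu hv (n + 1) rfl) (by omega), sub_zero]

lemma three_zero_comm {u v : V} (hu : u ∈ S.halfWeightSpace 3) (hv : v ∈ S.halfWeightSpace 3) :
    S.mode u 0 v = S.mode v 0 u := by
  have := h.skew' hu hv 0 (by norm_num)
  have h3 : (3 : ZMod 2).val = 1 := by decide
  simpa [h3] using this.symm

lemma four_three_one_comm {a u : V} (ha : a ∈ S.halfWeightSpace 4)
    (hu : u ∈ S.halfWeightSpace 3) : S.mode u 1 a = S.mode a 1 u := by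
  have := h.skew' ha hu 1 (by norm_num)
  have h4 : (4 : ZMod 2).val = 0 := by decide
  simpa [h4] using this

lemma four_one_comm {a b : V} (ha : a ∈ S.halfWeightSpace 4)
    (hb : b ∈ S.halfWeightSpace 4) : S.mode a 1 b = S.mode b 1 a := by
  have := h.skew' ha hb 1 (by norm_num)
  have h4 : (4 : ZMod 2).val = 0 := by decide
  simpa [h4] using this.symm

lemma four_three_comm {a b : V} (ha : a ∈ S.halfWeightSpace 4)
    (hb : b ∈ S.halfWeightSpace 4) : S.mode a 3 b = S.mode b 3 a := by
  have := h.skew' ha hb 3 (by norm_num)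
  have h4 : (4 : ZMod 2).val = 0 := by decide
  have hz : (-1 : ℂ) ^ (3 : ℤ) = -1 := by norm_num [zpow_ofNat]
  simpa [h4, hz] using this.symm

lemma four_zero_skew {a b : V} (ha : a ∈ S.halfWeightSpace 4)
    (hb : b ∈ S.halfWeightSpace 4) :
    S.mode b 0 a = S.L (-1) (S.mode a 1 b) - S.mode a 0 b := by
  have := h.skew ha hb 0 (by norm_num)
  have h4 : (4 : ZMod 2).val = 0 := by decide
  simp [h4] at this
  rw [← neg_neg (S.mode b 0 a), this, neg_sub]

/-- For x = L(-1)z with z of weight 3/2, L(1)x = 2L(0)z = 3z. -/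
lemma five_eq {x : V} (hx : x ∈ S.halfWeightSpace 5) :
    x = (1 / 3 : ℂ) • S.L (-1) (S.L 1 x) := by
  obtain ⟨z, hz, rfl⟩ := h.five_le hx
  rw [S.L_one_L_neg_one hz, h.L_one_eq_zero hz (Or.inl rfl), map_zero, zero_add, map_smul,
    smul_smul]
  norm_num

lemma four_zero_three {a u : V} (ha : a ∈ S.halfWeightSpace 4) (hu : u ∈ S.halfWeightSpace 3) :
    S.mode a 0 u = (2 / 3 : ℂ) • S.L (-1) (S.mode a 1 u) := by
  rw [h.five_eq (S.mode_mem ha hu 0 (by norm_num)), S.L_one_mode ha,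
    h.L_one_eq_zero hu (Or.inl rfl), h.L_one_eq_zero ha (Or.inr rfl)]
  simp only [map_zero, zero_add, mode_zero, LinearMap.zero_apply, add_zero, map_smul, smul_smul]
  norm_num

lemma three_zero_four {a u : V} (ha : a ∈ S.halfWeightSpace 4) (hu : u ∈ S.halfWeightSpace 3) :
    S.mode u 0 a = (1 / 3 : ℂ) • S.L (-1) (S.mode a 1 u) := by
  rw [h.five_eq (S.mode_mem hu ha 0 (by norm_num)), S.L_one_mode hu,
    h.L_one_eq_zero hu (Or.inl rfl), h.L_one_eq_zero ha (Or.inr rfl)]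
  simp only [map_zero, zero_add, mode_zero, LinearMap.zero_apply, add_zero, map_smul, smul_smul,
    h.four_three_one_comm ha hu]
  norm_num

omit h in
lemma four_mode {p : ℤ} {a v : V} (ha : a ∈ S.halfWeightSpace 4) (hv : v ∈ S.halfWeightSpace p)
    (k : ℕ) (n : ℤ) (w : V) :
    S.mode a k (S.mode v n w) = S.mode v n (S.mode a k w)
      + ∑ i ∈ Finset.range (k + 1), (k.choose i : ℂ) • S.mode (S.mode a i v) (n + k - i) w := by
  have h4 : (4 : ZMod 2).val = 0 := by decide
  simpa [h4] using S.mode_commutator (S.halfWeightSpace_le_parityPart _ ha)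
    (S.halfWeightSpace_le_parityPart _ hv) k n w

omit h in
lemma mode_four {p : ℤ} {a v : V} (hv : v ∈ S.halfWeightSpace p) (ha : a ∈ S.halfWeightSpace 4)
    (k : ℕ) (n : ℤ) (w : V) :
    S.mode v k (S.mode a n w) = S.mode a n (S.mode v k w)
      + ∑ i ∈ Finset.range (k + 1), (k.choose i : ℂ) • S.mode (S.mode v i a) (n + k - i) w := by
  have h4 : (4 : ZMod 2).val = 0 := by decide
  simpa [h4] using S.mode_commutator (S.halfWeightSpace_le_parityPart _ hv)
    (S.halfWeightSpace_le_parityPart _ ha) k n w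

/-- [a₁, u₀] = (a₀u)₁ + (a₁u)₀, and (a₀u)₁ = -(2/3)(a₁u)₀ by `four_zero_three`. -/
lemma four_one_three_zero {a u : V} (ha : a ∈ S.halfWeightSpace 4)
    (hu : u ∈ S.halfWeightSpace 3) (v : V) :
    S.mode a 1 (S.mode u 0 v)
      = S.mode u 0 (S.mode a 1 v) + (1 / 3 : ℂ) • S.mode (S.mode a 1 u) 0 v := by
  have := four_mode ha hu 1 0 v
  simp [Finset.sum_range_succ, h.four_zero_three ha hu, S.L_neg_one_derivative] at this
  rw [this]
  module

/-- The action of `V_(2)` on `V_(3/2)` is self-adjoint for the product `u₀ v`. -/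
lemma three_zero_adjoint {a u v : V} (ha : a ∈ S.halfWeightSpace 4)
    (hu : u ∈ S.halfWeightSpace 3) (hv : v ∈ S.halfWeightSpace 3) :
    S.mode (S.mode a 1 u) 0 v = S.mode u 0 (S.mode a 1 v) := by
  have h1 := h.four_one_three_zero ha hu v
  have h2 := h.four_one_three_zero ha hv u
  have hau : S.mode a 1 u ∈ S.halfWeightSpace 3 := S.mode_mem ha hu 1 (by norm_num)
  have hav : S.mode a 1 v ∈ S.halfWeightSpace 3 := S.mode_mem ha hv 1 (by norm_num)
  -- The left side is symmetric in u and v; equating both expansions leaves 1 - 1/3 = 2/3 of the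
  -- difference.
  rw [h.three_zero_comm hv hu, h1, h.three_zero_comm hv hau, h.three_zero_comm hav hu] at h2
  have h3 : (2 / 3 : ℂ) • (S.mode (S.mode a 1 u) 0 v - S.mode u 0 (S.mode a 1 v)) = 0 := by
    rw [← sub_eq_zero.2 h2.symm]
    module
  exact sub_eq_zero.1 ((smul_eq_zero.1 h3).resolve_left (by norm_num))

lemma four_one_three_zero' {a u v : V} (ha : a ∈ S.halfWeightSpace 4)
    (hu : u ∈ S.halfWeightSpace 3) (hv : v ∈ S.halfWeightSpace 3) :
    S.mode a 1 (S.mode u 0 v) = (4 / 3 : ℂ) • S.mode u 0 (S.mode a 1 v) := by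
  rw [h.four_one_three_zero ha hu, h.three_zero_adjoint ha hu hv]
  module

lemma three_zero_action_comm {a b u v : V} (ha : a ∈ S.halfWeightSpace 4)
    (hb : b ∈ S.halfWeightSpace 4) (hu : u ∈ S.halfWeightSpace 3) (hv : v ∈ S.halfWeightSpace 3) :
    S.mode u 0 (S.mode a 1 (S.mode b 1 v)) = S.mode u 0 (S.mode b 1 (S.mode a 1 v)) := by
  have hav : S.mode a 1 v ∈ S.halfWeightSpace 3 := S.mode_mem ha hv 1 (by norm_num)
  have hbv : S.mode b 1 v ∈ S.halfWeightSpace 3 := S.mode_mem hb hv 1 (by norm_num)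
  have hbu : S.mode b 1 u ∈ S.halfWeightSpace 3 := S.mode_mem hb hu 1 (by norm_num)
  have h1 : S.mode a 1 (S.mode b 1 (S.mode u 0 v))
      = (4 / 3 : ℂ) • (4 / 3 : ℂ) • S.mode u 0 (S.mode a 1 (S.mode b 1 v)) := by
    rw [h.four_one_three_zero' hb hu hv, map_smul, h.four_one_three_zero' ha hu hbv]
  have h2 : S.mode a 1 (S.mode b 1 (S.mode u 0 v))
      = (4 / 3 : ℂ) • (4 / 3 : ℂ) • S.mode u 0 (S.mode b 1 (S.mode a 1 v)) := by
    rw [h.four_one_three_zero' hb hu hv, ← h.three_zero_adjoint hb hu hv, map_smul,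
      h.four_one_three_zero' ha hbu hv, h.three_zero_adjoint hb hu hav]
  have h43 : (4 / 3 : ℂ) ≠ 0 := by norm_num
  exact smul_right_injective V h43 (smul_right_injective V h43 (h1.symm.trans h2))

lemma L_two_three_zero {u x : V} (hu : u ∈ S.halfWeightSpace 3)
    (hx : x ∈ S.halfWeightSpace 3) :
    S.L 2 (S.mode u 0 x) = (3 / 2 : ℂ) • S.mode u 2 x := by
  have h1 := S.L_commutator hu 3 0 x
  have h2 : S.L 2 x = 0 := h.eq_zero (S.L_mem hx 2 rfl) (by norm_num) (by norm_num)
  have h3 : S.L 2 u = 0 := h.eq_zero (S.L_mem hu 2 rfl) (by norm_num) (by norm_num)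
  have h31 : Nat.choose 3 2 = 3 := rfl
  norm_num [Finset.sum_range_succ, h2, h3, h.L_one_eq_zero hu (Or.inl rfl),
    S.L_neg_one_derivative, mem_halfWeightSpace.1 hu, h31] at h1
  rw [h1]
  module

/-! ### Consequences of nondegeneracy. -/

variable (hs : S.IsSimple)

include hs

lemma eq_zero_of_quasiPrimary {r : ℤ} (hr : 0 < r) {y : V} (hy : y ∈ S.halfWeightSpace r)
    (hL : S.L 1 y = 0) (hy' : ∀ w ∈ S.halfWeightSpace r, S.mode w (r - 1) y = 0) : y = 0 :=
  ConformalVertexSuperalgebra.eq_zero_of_quasiPrimary hs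
    (fun k hk => h.eq_bot k (by omega) (by omega)) (h.eq_bot 2 le_rfl (by norm_num)) hr hy hL hy'

lemma action_comm {a b v : V} (ha : a ∈ S.halfWeightSpace 4)
    (hb : b ∈ S.halfWeightSpace 4) (hv : v ∈ S.halfWeightSpace 3) :
    S.mode a 1 (S.mode b 1 v) = S.mode b 1 (S.mode a 1 v) := by
  have hav : S.mode a 1 v ∈ S.halfWeightSpace 3 := S.mode_mem ha hv 1 (by norm_num)
  have hbv : S.mode b 1 v ∈ S.halfWeightSpace 3 := S.mode_mem hb hv 1 (by norm_num)
  have hx : S.mode a 1 (S.mode b 1 v) - S.mode b 1 (S.mode a 1 v) ∈ S.halfWeightSpace 3 :=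
    sub_mem (S.mode_mem ha hbv 1 (by norm_num)) (S.mode_mem hb hav 1 (by norm_num))
  refine sub_eq_zero.1 (h.eq_zero_of_quasiPrimary hs (r := 3) (by norm_num) hx
    (h.L_one_eq_zero hx (Or.inl rfl)) fun u hu => ?_)
  have h1 := h.L_two_three_zero hu hx
  rw [map_sub, h.three_zero_action_comm ha hb hu hv, sub_self, map_zero] at h1
  exact (smul_eq_zero.1 h1.symm).resolve_left (by norm_num)

/-- A quasi-primary vector of weight `3` annihilated by `u₂` for `u` of weight `3 / 2`
vanishes. -/
lemma six_eq_zero {y : V} (hy : y ∈ S.halfWeightSpace 6) (hL : S.L 1 y = 0)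
    (hy' : ∀ u ∈ S.halfWeightSpace 3, S.mode u 2 y = 0) : y = 0 := by
  have hu1 : ∀ u ∈ S.halfWeightSpace 3, S.mode u 1 y = 0 := by
    intro u hu
    rw [h.five_eq (S.mode_mem hu hy 1 (by norm_num)), S.L_one_mode hu, hL,
      h.L_one_eq_zero hu (Or.inl rfl)]
    norm_num [hy' u hu]
  have hu4 : ∀ u ∈ S.halfWeightSpace 3, ∀ v ∈ S.halfWeightSpace 3,
      S.mode v 4 (S.mode u 0 y) = 0 := by
    intro u hu v hv
    -- This vector has weight 1; applying L(1) to it gives -2 v₄u₀y.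
    have h0 : S.mode v 3 (S.mode u 0 y) = 0 :=
      h.mode_eq_zero hv (S.mode_mem hu hy 0 rfl) 3 (by norm_num) (by norm_num)
    have hL0 : S.L 1 (S.mode u 0 y) = 0 := by
      rw [S.L_one_mode hu, hL, h.L_one_eq_zero hu (Or.inl rfl)]
      simp [hu1 u hu]
    have h1 := S.L_one_mode hv 3 (S.mode u 0 y)
    rw [h0, hL0, h.L_one_eq_zero hv (Or.inl rfl)] at h1
    norm_num at h1
    exact h1
  refine h.eq_zero_of_quasiPrimary hs (r := 6) (by norm_num) hy hL fun w hw => ?_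
  obtain ⟨_, ⟨x, hx, rfl⟩, z, hz, rfl⟩ := Submodule.mem_sup.1 (h.six_le hw)
  rw [mode_add, LinearMap.add_apply]
  have hxy : S.mode (S.L (-1) x) (6 - 1) y = 0 := by
    have h0 : S.mode x 3 y = 0 := h.mode_eq_zero hx hy 3 (by norm_num) (by norm_num)
    have h1 := S.L_one_mode hx 3 y
    rw [h0, hL, h.L_one_eq_zero hx (Or.inr rfl)] at h1
    norm_num at h1
    rw [S.L_neg_one_derivative]
    norm_num [h1]
  rw [hxy, zero_add]
  clear hw
  induction hz using Submodule.span_induction with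
  | mem z hz =>
    obtain ⟨u, hu, v, hv, rfl⟩ := hz
    -- In (u₋₁v)₅y the inner v_{5+i}y has negative weight, so only v_{4-i}uᵢy with i ≤ 2 needs the
    -- facts above.
    rw [S.mode_mode (S.halfWeightSpace_le_parityPart _ hu)
      (S.halfWeightSpace_le_parityPart _ hv)]
    refine finsum_eq_zero_of_forall_eq_zero fun i => ?_
    have h1 : S.mode v (6 - 1 + i) y = 0 := h.mode_eq_zero hv hy _ (by omega) (by omega)
    have h2 : S.mode v (-1 + (6 - 1) - i) (S.mode u i y) = 0 := by
      match i with
      | 0 => simpa using hu4 u hu v hv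
      | 1 => simp [hu1 u hu]
      | 2 => simp [hy' u hu]
      | i + 3 => rw [h.mode_eq_zero hu hy _ (by push_cast; omega) (by push_cast; omega), map_zero]
    rw [h1, h2]
    simp
  | zero => simp
  | add a b _ _ ha hb => rw [mode_add, LinearMap.add_apply, ha, hb, add_zero]
  | smul c a _ ha => rw [mode_smul, LinearMap.smul_apply, ha, smul_zero]

omit hs in
-- In [u₂, a₀] the term (u₀a)₂ contributes -2/3 and 2(u₁a)₁ contributes 2 times (a₁u)₁.
lemma three_two_four_zero {a b u : V} (ha : a ∈ S.halfWeightSpace 4)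
    (hb : b ∈ S.halfWeightSpace 4) (hu : u ∈ S.halfWeightSpace 3) :
    S.mode u 2 (S.mode a 0 b) = (4 / 3 : ℂ) • S.mode b 1 (S.mode a 1 u) := by
  have h1 := mode_four hu ha 2 0 b
  have hub : S.mode u 2 b = 0 := h.mode_eq_zero hu hb 2 (by norm_num) (by norm_num)
  have hua : S.mode u 2 a = 0 := h.mode_eq_zero hu ha 2 (by norm_num) (by norm_num)
  have hau : S.mode a 1 u ∈ S.halfWeightSpace 3 := S.mode_mem ha hu 1 (by norm_num)
  norm_num [Finset.sum_range_succ, hub, hua, h.three_zero_four ha hu,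
    h.four_three_one_comm ha hu, S.L_neg_one_derivative, h.four_three_one_comm hb hau] at h1
  rw [h1]
  module

/-- `a₀ b = ½ L(-1) a₁ b` for `a`, `b` of weight two. -/
lemma four_zero_four {a b : V} (ha : a ∈ S.halfWeightSpace 4) (hb : b ∈ S.halfWeightSpace 4) :
    S.mode a 0 b = (1 / 2 : ℂ) • S.L (-1) (S.mode a 1 b) := by
  have hab : S.mode a 1 b ∈ S.halfWeightSpace 4 := S.mode_mem ha hb 1 (by norm_num)
  rw [← sub_eq_zero]
  refine h.six_eq_zero hs (sub_mem (S.mode_mem ha hb 0 (by norm_num))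
    (Submodule.smul_mem _ _ (S.L_mem hab _ (by norm_num)))) ?_ fun u hu => ?_
  · rw [map_sub, map_smul, S.L_one_L_neg_one hab, h.L_one_eq_zero hab (Or.inr rfl),
      S.L_one_mode ha, h.L_one_eq_zero hb (Or.inr rfl), h.L_one_eq_zero ha (Or.inr rfl)]
    norm_num [smul_smul]
  · have h1 := h.three_two_four_zero hb ha hu
    rw [h.four_zero_skew ha hb, map_sub, h.action_comm hs ha hb hu,
      ← h.three_two_four_zero ha hb hu] at h1
    rw [map_sub, map_smul, sub_eq_iff_eq_add.1 h1]
    module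

/-- [a₁, b₁] = (a₀b)₂ + (a₁b)₁, and (a₀b)₂ = -(a₁b)₁ by `four_zero_four`. -/
lemma four_one_left_comm {a b c : V} (ha : a ∈ S.halfWeightSpace 4)
    (hb : b ∈ S.halfWeightSpace 4) :
    S.mode a 1 (S.mode b 1 c) = S.mode b 1 (S.mode a 1 c) := by
  have h1 := four_mode ha hb 1 1 c
  simp [Finset.sum_range_succ, h.four_zero_four hs ha hb, S.L_neg_one_derivative] at h1
  exact h1

/-- On c, [a₃, b₁] reduces to (a₀b)₄ + 3(a₁b)₃ = (-2 + 3)(a₁b)₃, while b₁a₃c = 0 because a₃c is a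
multiple of 𝟏. -/
lemma form_assoc {a b c : V} (ha : a ∈ S.halfWeightSpace 4) (hb : b ∈ S.halfWeightSpace 4)
    (hc : c ∈ S.halfWeightSpace 4) :
    S.mode (S.mode a 1 b) 3 c = S.mode a 3 (S.mode b 1 c) := by
  have h1 := four_mode ha hb 3 1 c
  have h0 : S.mode b 1 (S.mode a 3 c) = 0 := by
    obtain ⟨t, ht⟩ := Submodule.mem_span_singleton.1
      (h.zero_le (S.mode_mem ha hc 3 (by norm_num)))
    simp [← ht, S.mode_vac_of_nonneg]
  have h2 : S.mode a 2 b = 0 := h.mode_eq_zero ha hb 2 (by norm_num) (by norm_num)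
  have h3 : S.mode (S.mode a 3 b) 1 c = 0 := by
    obtain ⟨t, ht⟩ := Submodule.mem_span_singleton.1
      (h.zero_le (S.mode_mem ha hb 3 (by norm_num)))
    simp [← ht, S.vac_mode]
  norm_num [Finset.sum_range_succ, h.four_zero_four hs ha hb, S.L_neg_one_derivative, h0, h2,
    h3] at h1
  rw [h1]
  module

end LowWeightShape

end ConformalVertexSuperalgebra

/-! ### The algebra and the form on V_(2). -/

theorem mainTheorem3 {V : Type*} [AddCommGroup V] [Module ℂ V]
    (S : VertexOperatorSuperalgebra V)
    (hsimple : S.IsSimple)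
    (hgen : S.StronglyGeneratedBy
      ((S.weightSpace (3 / 2) ⊔ S.weightSpace 2 : Submodule ℂ V) : Set V)) :
    (∀ a ∈ S.weightSpace 2, ∀ b ∈ S.weightSpace 2,
      S.mode a 0 b = (1 / 2 : ℂ) • S.L (-1) (S.mode a 1 b)) ∧
    ∃ (mul : S.weightSpace 2 →ₗ[ℂ] S.weightSpace 2 →ₗ[ℂ] S.weightSpace 2)
      (form : LinearMap.BilinForm ℂ (S.weightSpace 2)),
      (∀ a b : S.weightSpace 2, (mul a b : V) = S.mode (a : V) 1 (b : V)) ∧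
      (∀ a b : S.weightSpace 2, S.mode (a : V) 3 (b : V) = form a b • S.vac) ∧
      (∀ a b, mul a b = mul b a) ∧
      (∀ a b c, mul (mul a b) c = mul a (mul b c)) ∧
      (∃ e : S.weightSpace 2, (e : V) = (1 / 2 : ℂ) • S.omega ∧
        ∀ a, mul e a = a ∧ mul a e = a) ∧
      (∀ a b, form a b = form b a) ∧
      (∀ a b c, form (mul a b) c = form a (mul b c)) := by
  have h := ConformalVertexSuperalgebra.lowWeightShape hgen
  have e4 : S.halfWeightSpace 4 = S.weightSpace 2 := by
    norm_num [VertexSuperData.halfWeightSpace]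
  have hm : ∀ a : S.weightSpace 2, (a : V) ∈ S.halfWeightSpace 4 := fun a => e4.ge a.2
  have hmul : ∀ a b : S.weightSpace 2, S.mode (a : V) 1 (b : V) ∈ S.weightSpace 2 := fun a b =>
    e4.le (S.mode_mem (hm a) (hm b) 1 (by norm_num))
  have hvac := ConformalVertexSuperalgebra.vac_ne_zero hsimple
  have hform : ∀ a b : S.weightSpace 2, ∃ c : ℂ, c • S.vac = S.mode (a : V) 3 (b : V) :=
    fun a b => Submodule.mem_span_singleton.1
      (h.zero_le (S.mode_mem (hm a) (hm b) 3 (by norm_num)))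
  choose f hf using hform
  have hinj : ∀ c d : ℂ, c • S.vac = d • S.vac → c = d := fun c d hcd =>
    smul_left_injective ℂ hvac hcd
  let mul : S.weightSpace 2 →ₗ[ℂ] S.weightSpace 2 →ₗ[ℂ] S.weightSpace 2 :=
    LinearMap.mk₂ ℂ (fun a b => ⟨S.mode (a : V) 1 (b : V), hmul a b⟩)
      (fun a b c => Subtype.ext (by simp)) (fun t a b => Subtype.ext (by simp))
      (fun a b c => Subtype.ext (by simp)) (fun t a b => Subtype.ext (by simp))
  let form : LinearMap.BilinForm ℂ (S.weightSpace 2) :=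
    LinearMap.mk₂ ℂ f
      (fun a b c => hinj _ _ (by rw [add_smul, hf, hf, hf]; simp))
      (fun t a b => hinj _ _ (by rw [smul_assoc, hf, hf]; simp))
      (fun a b c => hinj _ _ (by rw [add_smul, hf, hf, hf]; simp))
      (fun t a b => hinj _ _ (by rw [smul_assoc, hf, hf]; simp))
  have hcomm : ∀ a b, mul a b = mul b a := fun a b =>
    Subtype.ext (h.four_one_comm (hm a) (hm b))
  refine ⟨fun a ha b hb => h.four_zero_four hsimple (hm ⟨a, ha⟩) (hm ⟨b, hb⟩), mul, form,
    fun a b => rfl, fun a b => (hf a b).symm, hcomm, fun a b c => ?_, ?_, fun a b => ?_,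
    fun a b c => ?_⟩
  · rw [hcomm (mul a b) c, hcomm b c]
    -- Given commutativity, associativity is the commutation of multiplication operators.
    have : mul c (mul a b) = mul a (mul c b) :=
      Subtype.ext (h.four_one_left_comm hsimple (hm c) (hm a))
    exact this
  · refine ⟨⟨(1 / 2 : ℂ) • S.omega, Submodule.smul_mem _ _ (e4.le S.omega_mem)⟩, rfl, fun a => ?_⟩
    rw [hcomm a, and_self]
    apply Subtype.ext
    have hL : S.L 0 (a : V) = (((4 : ℤ) : ℂ) / 2) • (a : V) :=
      VertexSuperData.mem_halfWeightSpace.1 (hm a)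
    change S.mode ((1 / 2 : ℂ) • S.omega) 1 (a : V) = a
    rw [VertexSuperData.mode_smul, VertexSuperData.mode_omega, LinearMap.smul_apply, sub_self,
      hL, smul_smul]
    norm_num
  · refine hinj _ _ ((hf a b).trans (Eq.trans ?_ (hf b a).symm))
    exact h.four_three_comm (hm a) (hm b)
  · refine hinj _ _ ((hf _ c).trans (Eq.trans ?_ (hf a _).symm))
    exact h.form_assoc hsimple (hm a) (hm b) (hm c)
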